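/- \textbf{Theorem (R-NN performance).} A collectible-reward MDP with $n\ge 1$ rewards consists of a set of states, a set of actions with deterministic transitions (one time step each), an initial state $s_0$ and reward states $s_1,\dots,s_n$; a reward of $1$ is received at the first visit to $s_i$, $i=1,\dots,n$ (a visit at time $0$ counts), and each reward can be collected only once. Let $d(s,t)$ be the length of a shortest path from $s$ to $t$. Assume that every reward state can be reached from $s_0$ and from every other reward state, and that distances between rewards are symmetric, $d(s_i,s_j)=d(s_j,s_i)$ for $1\le i,j\le n$. For each $j$ let an option $o_j$ be given that leads from $s_0$ and from every reward state to $s_j$ along a shortest path. Let $\gamma\in[0,1]$ (with $0^0=1$) and $$\mathrm{OPT}=\max_{\sigma\in\mathrm{Sym}(n)}\ \sum_{k=1}^{n}\gamma^{\,d(s_0,s_{\sigma(1)})+\sum_{t=2}^{k} d(s_{\sigma(t-1)},s_{\sigma(t)})}.$$ The policy NN repeatedly follows the option of a nearest reward not yet collected (ties are broken arbitrarily) until all rewards are collected. The policy Random-NN flips a fair coin; on heads it first follows the option $o_j$ of a reward $j$ chosen uniformly at random from $\{1,\dots,n\}$ until it reaches $s_j$, and then runs NN from there with the remaining rewards; on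 tails it runs NN from $s_0$. Rewards passed while an option is followed are collected at that time. A reward collected at time $t$ contributes $\gamma^t$ to the return. Let $\text{R-NN}$ be the expected return of Random-NN. There is an absolute constant $c>0$ such that for every $n\ge 1$, every such MDP with $n$ rewards, every choice of the options and of the tie-breaking, and every $\gamma\in[0,1]$, $$\text{R-NN}\ \ge\ c\,\frac{\log n}{n}\,\mathrm{OPT}.$$ -/

import Mathlib

/-- A collectible-reward MDP with `n` rewards and deterministic dynamics: taking action `a` in
state `s` leads, in one time step, to the state `step s a`; the agent starts in `init`; the
`i`-th reward sits in the state `site i` and can be collected once. -/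
structure CollectibleMDP (S A : Type*) (n : ℕ) where
  step : S → A → S
  init : S
  site : Fin n → S

namespace CollectibleMDP

open Classical in
/-- The local reward signal `R_i`. -/
noncomputable def localReward {S A : Type*} {n : ℕ} (M : CollectibleMDP S A n)
    (i : Fin n) (s : S) : ℝ :=
  if s = M.site i then 1 else 0

/-- The reward received in state `s` when the rewards in `C` have been collected before:
the sum of the local rewards `R_i(s)` over the rewards `i` that are still available. -/
noncomputable def reward {S A : Type*} {n : ℕ} (M : CollectibleMDP S A n)
    (C : Finset (Fin n)) (s : S) : ℝ :=
  ∑ i ∈ Cᶜ, M.localReward i s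

/-- The length of a shortest path from `s` to `t`: the least number of actions that lead
from `s` to `t`. (The value is only used where `t` can be reached from `s`.) -/
noncomputable def dist {S A : Type*} {n : ℕ} (M : CollectibleMDP S A n) (s t : S) : ℕ :=
  sInf {k : ℕ | ∃ l : List A, l.length = k ∧ l.foldl M.step s = t}

/-! ### The reward-discounted travelling salesman problem -/

/-- The length of the `k`-th leg (`k = 0, …, n - 1`) of the tour that starts in `init` and visits
the rewards in the order `σ 0, σ 1, …, σ (n - 1)`. -/
noncomputable def tourLeg {S A : Type*} {n : ℕ} (M : CollectibleMDP S A n)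
    (σ : Equiv.Perm (Fin n)) (k : Fin n) : ℕ :=
  M.dist
    (if (k : ℕ) = 0 then M.init
      else M.site (σ ⟨(k : ℕ) - 1, lt_of_le_of_lt (Nat.sub_le _ _) k.isLt⟩))
    (M.site (σ k))

/-- The discounted return of a tour. -/
noncomputable def tourReturn {S A : Type*} {n : ℕ} (M : CollectibleMDP S A n) (γ : ℝ)
    (σ : Equiv.Perm (Fin n)) : ℝ :=
  ∑ k : Fin n, γ ^ (∑ t ∈ Finset.Iic k, M.tourLeg σ t)

/-- `OPT`, the maximal discounted return over all orders of collecting the rewards. -/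
noncomputable def opt {S A : Type*} {n : ℕ} (M : CollectibleMDP S A n) (γ : ℝ) : ℝ :=
  Finset.univ.sup' Finset.univ_nonempty (fun σ : Equiv.Perm (Fin n) => M.tourReturn γ σ)

/-! ### Options and their execution -/

/-- The state in which the agent is after following option `o j` for `t` steps from `x`. -/
def optionState {S A : Type*} {n : ℕ} (M : CollectibleMDP S A n) (o : Fin n → S → A)
    (j : Fin n) (x : S) (t : ℕ) : S :=
  (fun s => M.step s (o j s))^[t] x

/-- `o` is a family of optimal options, one per reward: started in the initial state or in any
reward state, `o j` arrives at reward `j` along a shortest path. In particular every reward can be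
reached from the initial state and from every other reward. -/
def OptimalOptions {S A : Type*} {n : ℕ} (M : CollectibleMDP S A n) (o : Fin n → S → A) : Prop :=
  ∀ x : S, (x = M.init ∨ ∃ i, x = M.site i) →
    ∀ j : Fin n, M.optionState o j x (M.dist x (M.site j)) = M.site j

open Classical in
/-- The rewards that have been collected strictly before time `t` when option `o j` is followed
from state `x`, with the rewards in `C` collected beforehand. -/
noncomputable def collectedBefore {S A : Type*} {n : ℕ} (M : CollectibleMDP S A n)
    (o : Fin n → S → A) (C : Finset (Fin n)) (x : S) (j : Fin n) (t : ℕ) : Finset (Fin n) :=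
  C ∪ Finset.univ.filter (fun i => ∃ u < t, M.optionState o j x u = M.site i)

/-- The discounted reward received while following option `o j` from state `x` until reward `j` is
reached (rewards passed on the way are collected too), with the rewards in `C` collected
beforehand. -/
noncomputable def legReturn {S A : Type*} {n : ℕ} (M : CollectibleMDP S A n) (γ : ℝ)
    (o : Fin n → S → A) (C : Finset (Fin n)) (x : S) (j : Fin n) : ℝ :=
  ∑ t ∈ Finset.range (M.dist x (M.site j) + 1),
    γ ^ t * M.reward (M.collectedBefore o C x j t) (M.optionState o j x t)

/-- The rewards collected once option `o j`, followed from `x`, has reached reward `j`. -/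
noncomputable def collectedAfter {S A : Type*} {n : ℕ} (M : CollectibleMDP S A n)
    (o : Fin n → S → A) (C : Finset (Fin n)) (x : S) (j : Fin n) : Finset (Fin n) :=
  M.collectedBefore o C x j (M.dist x (M.site j) + 1)

/-! ### Nearest neighbour and Random-NN -/

/-- `pick` is a nearest-neighbour rule: given the history `h` of the options followed so far, the
current state `x`, and the set `C` of the rewards collected so far, it picks a nearest remaining
reward. Ties may be broken in any way. -/
def IsNearestNeighbor {S A : Type*} {n : ℕ} (M : CollectibleMDP S A n)
    (pick : List (Fin n) → S → Finset (Fin n) → Fin n) : Prop :=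
  ∀ (h : List (Fin n)) (x : S) (C : Finset (Fin n)), C ≠ Finset.univ →
    pick h x C ∉ C ∧ ∀ i, i ∉ C → M.dist x (M.site (pick h x C)) ≤ M.dist x (M.site i)

/-- The discounted return of the policy that follows the options chosen by `pick` until all
rewards are collected, for at most `m` options. -/
noncomputable def pickReturn {S A : Type*} {n : ℕ} (M : CollectibleMDP S A n) (γ : ℝ)
    (o : Fin n → S → A) (pick : List (Fin n) → S → Finset (Fin n) → Fin n) :
    ℕ → List (Fin n) → S → Finset (Fin n) → ℝ
  | 0, _, _, _ => 0
  | m + 1, h, x, C =>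
    if C = Finset.univ then 0
    else
      M.legReturn γ o C x (pick h x C) +
        γ ^ M.dist x (M.site (pick h x C)) *
          pickReturn M γ o pick m (h ++ [pick h x C]) (M.site (pick h x C))
            (M.collectedAfter o C x (pick h x C))

/-- The return of NN from the initial state. (Each option collects a new reward, so `n` options
suffice to collect all of them.) -/
noncomputable def nnReturn {S A : Type*} {n : ℕ} (M : CollectibleMDP S A n) (γ : ℝ)
    (o : Fin n → S → A) (pick : List (Fin n) → S → Finset (Fin n) → Fin n) : ℝ :=
  M.pickReturn γ o pick n [] M.init ∅

/-- The return of the policy that first follows option `o j` to reward `j` and then runs NN. -/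
noncomputable def firstThenNNReturn {S A : Type*} {n : ℕ} (M : CollectibleMDP S A n) (γ : ℝ)
    (o : Fin n → S → A) (pick : List (Fin n) → S → Finset (Fin n) → Fin n) (j : Fin n) : ℝ :=
  M.legReturn γ o ∅ M.init j +
    γ ^ M.dist M.init (M.site j) *
      M.pickReturn γ o pick n [j] (M.site j) (M.collectedAfter o ∅ M.init j)

/-- The expected return of Random-NN: with probability `1/2` it runs NN, and with probability
`1/2` it first collects a uniformly random reward and then runs NN. -/
noncomputable def randomNNReturn {S A : Type*} {n : ℕ} (M : CollectibleMDP S A n) (γ : ℝ)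
    (o : Fin n → S → A) (pick : List (Fin n) → S → Finset (Fin n) → Fin n) : ℝ :=
  1 / 2 * M.nnReturn γ o pick +
    1 / 2 * ∑ j : Fin n, (1 / (n : ℝ)) * M.firstThenNNReturn γ o pick j

end CollectibleMDP

/-!
Let `γ < 1` and fix a number `p` of rewards. Choose a radius `δ` with `γ ^ (2 ^ p * δ)` about `1/2`,
and call a reward dense if the optimal tour collects at least `p` rewards (itself included) within
`δ` time steps of it, and sparse otherwise.

By symmetry of the distances, the rewards that the tour collects within `δ` steps of a dense reward
lie within distance `δ` of it. Each option followed by NN at most doubles the distance to the ones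
still missing, so started at a dense reward NN collects `p` rewards within `2 ^ p * δ` steps, losing
only a factor of about `2` through discounting. The heads branch therefore obtains, on average over
its first reward, a `p / (2 n)` fraction of the contribution of the dense rewards to the tour. The
sparse rewards are spread out so much that their contribution is at most a geometric series,
`p * 2 ^ (p + 1)` times the value of the nearest reward, which the tails branch collects. Taking `p`
to be about `(log₂ n) / 3` balances the two cases.
-/

section Clusters

open Finset

theorem exists_pow_succ_lt_and_le_pow {x y : ℝ} (hx0 : 0 < x) (hx1 : x ≤ 1) (hy0 : 0 ≤ y)
    (hy1 : y < 1) : ∃ k : ℕ, y ^ (k + 1) < x ∧ x ≤ y ^ k := by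
  rcases hy0.eq_or_lt with rfl | hy0
  · exact ⟨0, by simpa using hx0, by simpa using hx1⟩
  · exact exists_nat_pow_near_of_lt_one hx0 hx1 hy0 hy1

theorem inv_one_sub_le_two_mul {y : ℝ} (hy0 : 0 ≤ y) (hy1 : y < 1) {N : ℕ}
    (hN : y ^ N ≤ 1 / 2) : (1 - y)⁻¹ ≤ 2 * N := by
  have bernoulli := one_add_mul_sub_le_pow (by linarith : -1 ≤ y) N
  rw [inv_le_iff_one_le_mul₀ (by linarith)]
  linarith

theorem sum_pow_comp_le_of_card_fiber_le {ι : Type*} {y : ℝ} (hy0 : 0 ≤ y) (hy1 : y < 1)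
    {s : Finset ι} {b : ι → ℕ} {p : ℕ} (hp : ∀ c ∈ s.image b, #{i ∈ s | b i = c} ≤ p) :
    ∑ i ∈ s, y ^ b i ≤ p * (1 - y)⁻¹ :=
  calc ∑ i ∈ s, y ^ b i
      = ∑ c ∈ s.image b, #{i ∈ s | b i = c} • y ^ c := sum_comp (y ^ ·) b
    _ ≤ ∑ c ∈ s.image b, p * y ^ c := sum_le_sum fun c hc => by
        rw [nsmul_eq_mul]
        have := hp c hc
        gcongr
    _ = p * ∑ c ∈ s.image b, y ^ c := (mul_sum _ _ _).symm
    _ ≤ p * (1 - y)⁻¹ := by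
        rw [← tsum_geometric_of_lt_one hy0 hy1]
        gcongr
        exact (summable_geometric_of_lt_one hy0 hy1).sum_le_tsum _ fun _ _ => pow_nonneg hy0 _

theorem sum_pow_le_of_card_near_le {ι : Type*} {γ : ℝ} (hγ0 : 0 ≤ γ) (hγ1 : γ < 1)
    {s : Finset ι} {T : ι → ℕ} {D δ p : ℕ} (hD : ∀ i ∈ s, D ≤ T i)
    (hp : ∀ i ∈ s, #{j ∈ s | Nat.dist (T i) (T j) ≤ δ} ≤ p) :
    ∑ i ∈ s, γ ^ T i ≤ γ ^ D * (p * (1 - γ ^ (δ + 1))⁻¹) := by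
  let bin : ι → ℕ := fun i => (T i - D) / (δ + 1)
  have near_of_bin_eq {i j : ι} (hi : i ∈ s) (hj : j ∈ s) (hij : bin j = bin i) :
      Nat.dist (T i) (T j) ≤ δ := by
    have hi_div := Nat.div_add_mod (T i - D) (δ + 1)
    have hj_div := Nat.div_add_mod (T j - D) (δ + 1)
    have hi_mod := Nat.mod_lt (T i - D) δ.succ_pos
    have hj_mod := Nat.mod_lt (T j - D) δ.succ_pos
    have hDi := hD i hi
    have hDj := hD j hj
    rw [show (T j - D) / (δ + 1) = (T i - D) / (δ + 1) from hij] at hj_div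
    simp only [Nat.dist, Nat.succ_eq_add_one] at *
    omega
  have card_bin_le : ∀ c ∈ s.image bin, #{i ∈ s | bin i = c} ≤ p := by
    simp only [forall_mem_image]
    intro i hi
    refine (card_le_card fun j hj => ?_).trans (hp i hi)
    obtain ⟨hj, hij⟩ := mem_filter.1 hj
    exact mem_filter.2 ⟨hj, near_of_bin_eq hi hj hij⟩
  calc ∑ i ∈ s, γ ^ T i
      ≤ ∑ i ∈ s, γ ^ D * (γ ^ (δ + 1)) ^ bin i := sum_le_sum fun i hi => by
        rw [← pow_mul, ← pow_add]
        have hbin : (δ + 1) * bin i ≤ T i - D := Nat.mul_div_le _ _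
        have hDi := hD i hi
        exact pow_le_pow_of_le_one hγ0 hγ1.le (by omega)
    _ = γ ^ D * ∑ i ∈ s, (γ ^ (δ + 1)) ^ bin i := (mul_sum _ _ _).symm
    _ ≤ γ ^ D * (p * (1 - γ ^ (δ + 1))⁻¹) := by
        gcongr
        exact sum_pow_comp_le_of_card_fiber_le (pow_nonneg hγ0 _)
          (pow_lt_one₀ hγ0 hγ1 δ.succ_ne_zero) card_bin_le

theorem exists_radius_sum_sparse_le {ι : Type*} [Fintype ι] {γ : ℝ} (hγ0 : 0 ≤ γ) (hγ1 : γ ≤ 1)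
    {T : ι → ℕ} {D p N : ℕ} (hD : ∀ i, D ≤ T i) (hN : N ≠ 0) (hp : p ≤ Fintype.card ι) :
    ∃ δ : ℕ, 1 / 2 ≤ γ ^ (N * δ) ∧
      ∑ i with #{j | Nat.dist (T i) (T j) ≤ δ} < p, γ ^ T i ≤ 2 * p * N * γ ^ D := by
  rcases hγ1.eq_or_lt with rfl | hγ1
  · refine ⟨∑ i, T i, by norm_num, ?_⟩
    have all_near (i j : ι) : Nat.dist (T i) (T j) ≤ ∑ i, T i := by
      have hi := single_le_sum_of_canonicallyOrdered (f := T) (mem_univ i)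
      have hj := single_le_sum_of_canonicallyOrdered (f := T) (mem_univ j)
      unfold Nat.dist
      omega
    simp only [all_near, filter_true, card_univ, hp.not_gt, filter_false, sum_empty]
    positivity
  · obtain ⟨δ, hlt, hle⟩ := exists_pow_succ_lt_and_le_pow (x := 1 / 2) (by norm_num) (by norm_num)
      (pow_nonneg hγ0 N) (pow_lt_one₀ hγ0 hγ1 hN)
    refine ⟨δ, by rwa [pow_mul], ?_⟩
    have hinv : (1 - γ ^ (δ + 1))⁻¹ ≤ 2 * N :=
      inv_one_sub_le_two_mul (pow_nonneg hγ0 _) (pow_lt_one₀ hγ0 hγ1 δ.succ_ne_zero)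
        (by rw [pow_right_comm]; exact hlt.le)
    refine (sum_pow_le_of_card_near_le (δ := δ) hγ0 hγ1 (fun i _ => hD i) fun i hi =>
      (card_le_card (filter_subset_filter _ (subset_univ _))).trans
        (mem_filter.1 hi).2.le).trans ?_
    calc γ ^ D * (p * (1 - γ ^ (δ + 1))⁻¹) ≤ γ ^ D * (p * (2 * N)) := by gcongr
      _ = 2 * p * N * γ ^ D := by ring

theorem sum_pow_le_of_dense_le {ι : Type*} [Fintype ι] {γ : ℝ} (hγ0 : 0 ≤ γ) (hγ1 : γ ≤ 1)
    {T : ι → ℕ} {D p N : ℕ} (hD : ∀ i, D ≤ T i) (hN : N ≠ 0) (hp : p ≤ Fintype.card ι)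
    {F : ι → ℝ} (hF0 : ∀ i, 0 ≤ F i)
    (hF : ∀ i δ, p ≤ #{j | Nat.dist (T i) (T j) ≤ δ} → γ ^ (T i + N * δ) ≤ F i) :
    ∑ i, γ ^ T i ≤ 2 * ∑ i, F i + 2 * p * N * γ ^ D := by
  obtain ⟨δ, hδ, sparse⟩ := exists_radius_sum_sparse_le hγ0 hγ1 hD hN hp
  have dense_term (i : ι) (hi : ¬#{j | Nat.dist (T i) (T j) ≤ δ} < p) : γ ^ T i ≤ 2 * F i := by
    have hTF := hF i δ (not_lt.1 hi)
    have := mul_le_mul_of_nonneg_left hδ (pow_nonneg hγ0 (T i))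
    rw [pow_add] at hTF
    linarith
  have dense : ∑ i with ¬#{j | Nat.dist (T i) (T j) ≤ δ} < p, γ ^ T i ≤ 2 * ∑ i, F i := by
    rw [mul_sum]
    exact (sum_le_sum fun i hi => dense_term i (mem_filter.1 hi).2).trans
      (sum_le_univ_sum_of_nonneg fun i => mul_nonneg two_pos.le (hF0 i))
  rw [← sum_filter_not_add_sum_filter univ fun i => #{j | Nat.dist (T i) (T j) ≤ δ} < p]
  exact add_le_add dense sparse

theorem min_succ_card_sdiff_le {α : Type*} [DecidableEq α] {C C' : Finset α}
    (hnew : (C' \ C).Nonempty) (G : Finset α) (p : ℕ) :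
    min (p + 1) #(G \ C) ≤ #(C' \ C) + min p #(G \ C') := by
  have hcover : #(G \ C) ≤ #(C' \ C) + #(G \ C') :=
    (card_le_card fun a ha => by grind).trans (card_union_le _ _)
  have hpos := hnew.card_pos
  omega

theorem exists_log_le_three_mul_and_sq_mul_two_pow_le {n : ℕ} (hn : n ≠ 0) :
    ∃ p : ℕ, 0 < p ∧ p ≤ n ∧ Real.log n ≤ 3 * p ∧ p ^ 2 * 2 ^ p ≤ 8 * n := by
  refine ⟨Nat.log 2 n / 3 + 1, Nat.succ_pos _, ?_, ?_, ?_⟩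
  · have := Nat.log_lt_self 2 hn
    omega
  · have hlt : n ≤ 2 ^ (3 * (Nat.log 2 n / 3 + 1)) :=
      (Nat.lt_pow_succ_log_self one_lt_two n).le.trans
        (Nat.pow_le_pow_right two_pos (by omega))
    calc Real.log n ≤ Real.log (2 ^ (3 * (Nat.log 2 n / 3 + 1))) :=
          Real.log_le_log (by positivity) (by exact_mod_cast hlt)
      _ = 3 * (Nat.log 2 n / 3 + 1 : ℕ) * Real.log 2 := by
          rw [Real.log_pow, Nat.cast_mul, Nat.cast_ofNat]
      _ ≤ 3 * (Nat.log 2 n / 3 + 1 : ℕ) :=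
          mul_le_of_le_one_right (by positivity)
            ((Real.log_le_sub_one_of_pos two_pos).trans (by norm_num))
  · set q := Nat.log 2 n / 3
    calc (q + 1) ^ 2 * 2 ^ (q + 1) ≤ (2 ^ (q + 1)) ^ 2 * 2 ^ (q + 1) := by
          gcongr
          exact Nat.lt_two_pow_self.le
      _ = 8 * 2 ^ (3 * q) := by ring
      _ ≤ 8 * 2 ^ Nat.log 2 n := by
          gcongr
          · norm_num
          · exact Nat.mul_div_le _ _
      _ ≤ 8 * n := by
          gcongr
          exact Nat.pow_log_le_self 2 hn

end Clusters

namespace CollectibleMDP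

open Finset

variable {S A : Type*} {n : ℕ}

/-! ### Paths and distances -/

/-- Some sequence of actions leads from `s` to `t`. Only then is `M.dist s t` the length of a
path. -/
def Reachable (M : CollectibleMDP S A n) (s t : S) : Prop :=
  ∃ l : List A, l.foldl M.step s = t

section Paths

variable {M : CollectibleMDP S A n}

theorem dist_foldl_le_length (M : CollectibleMDP S A n) (s : S) (l : List A) :
    M.dist s (l.foldl M.step s) ≤ l.length :=
  Nat.sInf_le ⟨l, rfl, rfl⟩

theorem dist_self (M : CollectibleMDP S A n) (s : S) : M.dist s s = 0 :=
  Nat.le_zero.1 (M.dist_foldl_le_length s [])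

theorem Reachable.exists_length_eq_dist {s t : S} (h : M.Reachable s t) :
    ∃ l : List A, l.length = M.dist s t ∧ l.foldl M.step s = t := by
  obtain ⟨l, hl⟩ := h
  exact Nat.sInf_mem (s := {k | ∃ l : List A, l.length = k ∧ l.foldl M.step s = t}) ⟨_, l, rfl, hl⟩

theorem Reachable.dist_triangle {s t u : S} (hst : M.Reachable s t) (htu : M.Reachable t u) :
    M.dist s u ≤ M.dist s t + M.dist t u := by
  obtain ⟨l, hl, hlt⟩ := hst.exists_length_eq_dist
  obtain ⟨l', hl', hlu⟩ := htu.exists_length_eq_dist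
  have := M.dist_foldl_le_length s (l ++ l')
  rwa [List.foldl_append, hlt, hlu, List.length_append, hl, hl'] at this

theorem reachable_optionState (M : CollectibleMDP S A n) (o : Fin n → S → A) (j : Fin n) (x : S)
    (t : ℕ) : M.Reachable x (M.optionState o j x t) := by
  induction t with
  | zero => exact ⟨[], rfl⟩
  | succ t ih =>
    obtain ⟨l, hl⟩ := ih
    refine ⟨l ++ [o j (M.optionState o j x t)], ?_⟩
    rw [List.foldl_concat, hl, optionState, optionState, Function.iterate_succ_apply']

theorem OptimalOptions.reachable_init_site {o : Fin n → S → A} (ho : M.OptimalOptions o)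
    (j : Fin n) : M.Reachable M.init (M.site j) :=
  ho M.init (.inl rfl) j ▸ M.reachable_optionState o j M.init _

theorem OptimalOptions.reachable_site_site {o : Fin n → S → A} (ho : M.OptimalOptions o)
    (i j : Fin n) : M.Reachable (M.site i) (M.site j) :=
  ho (M.site i) (.inr ⟨i, rfl⟩) j ▸ M.reachable_optionState o j (M.site i) _

end Paths

/-! ### Tours -/

/-- The time at which the tour `σ` reaches its `k`-th reward, the exponent in `tourReturn`. -/
noncomputable def tourTime (M : CollectibleMDP S A n) (σ : Equiv.Perm (Fin n)) (k : Fin n) : ℕ :=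
  ∑ t ∈ Iic k, M.tourLeg σ t

section Tours

variable {M : CollectibleMDP S A n} (σ : Equiv.Perm (Fin n))

theorem tourTime_zero (M : CollectibleMDP S A n) (h : 0 < n) :
    M.tourTime σ ⟨0, h⟩ = M.dist M.init (M.site (σ ⟨0, h⟩)) := by
  have : Iic (⟨0, h⟩ : Fin n) = {⟨0, h⟩} := by
    ext t
    simp [Fin.le_def, Fin.ext_iff]
  simp [tourTime, this, tourLeg]

theorem tourTime_succ (M : CollectibleMDP S A n) {k : ℕ} (h : k + 1 < n) :
    M.tourTime σ ⟨k + 1, h⟩ = M.tourTime σ ⟨k, Nat.lt_of_succ_lt h⟩ +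
      M.dist (M.site (σ ⟨k, Nat.lt_of_succ_lt h⟩)) (M.site (σ ⟨k + 1, h⟩)) := by
  have : Iic (⟨k + 1, h⟩ : Fin n) =
      insert ⟨k + 1, h⟩ (Iic (⟨k, Nat.lt_of_succ_lt h⟩ : Fin n)) := by
    ext t
    simp only [mem_Iic, mem_insert, Fin.le_def, Fin.ext_iff]
    omega
  rw [tourTime, this, sum_insert (by simp [Fin.le_def]), add_comm]
  simp [tourTime, tourLeg]

theorem dist_init_site_le_tourTime (hinit : ∀ j, M.Reachable M.init (M.site j))
    (hsite : ∀ i j, M.Reachable (M.site i) (M.site j)) (k : Fin n) :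
    M.dist M.init (M.site (σ k)) ≤ M.tourTime σ k := by
  obtain ⟨k, hk⟩ := k
  induction k with
  | zero => exact (M.tourTime_zero σ hk).ge
  | succ k ih =>
    rw [tourTime_succ]
    exact ((hinit _).dist_triangle (hsite _ _)).trans (Nat.add_le_add_right (ih _) _)

theorem tourTime_add_dist_le_tourTime (hsite : ∀ i j, M.Reachable (M.site i) (M.site j))
    {a b : Fin n} (hab : a ≤ b) :
    M.tourTime σ a + M.dist (M.site (σ a)) (M.site (σ b)) ≤ M.tourTime σ b := by
  obtain ⟨b, hb⟩ := b
  induction b with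
  | zero =>
    obtain rfl : a = ⟨0, hb⟩ := le_antisymm hab (Nat.zero_le _)
    simp [dist_self]
  | succ b ih =>
    rcases hab.eq_or_lt with rfl | hlt
    · simp [dist_self]
    · have hprev := ih (Nat.lt_of_succ_lt hb) (Nat.le_of_lt_succ hlt)
      have htri := (hsite (σ a) (σ ⟨b, Nat.lt_of_succ_lt hb⟩)).dist_triangle
        (hsite _ (σ ⟨b + 1, hb⟩))
      rw [tourTime_succ]
      omega

theorem dist_site_le_natDist_tourTime (hsite : ∀ i j, M.Reachable (M.site i) (M.site j))
    (hsymm : ∀ i j : Fin n, M.dist (M.site i) (M.site j) = M.dist (M.site j) (M.site i))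
    (a b : Fin n) :
    M.dist (M.site (σ a)) (M.site (σ b)) ≤ Nat.dist (M.tourTime σ a) (M.tourTime σ b) := by
  wlog hab : a ≤ b generalizing a b
  · rw [hsymm, Nat.dist_comm]
    exact this b a (le_of_not_ge hab)
  have := tourTime_add_dist_le_tourTime σ hsite hab
  unfold Nat.dist
  omega

end Tours

/-! ### Following one option -/

section Options

variable {M : CollectibleMDP S A n} {o : Fin n → S → A} {γ : ℝ} {C : Finset (Fin n)} {x : S}
  {j : Fin n}

theorem reward_eq_card [DecidableEq S] (M : CollectibleMDP S A n) (C : Finset (Fin n)) (s : S) :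
    M.reward C s = #{i ∈ Cᶜ | s = M.site i} := by
  simp only [reward, localReward, natCast_card_filter]
  congr!

theorem reward_nonneg (M : CollectibleMDP S A n) (C : Finset (Fin n)) (s : S) :
    0 ≤ M.reward C s := by
  classical
  rw [reward_eq_card]
  positivity

theorem collectedBefore_zero (M : CollectibleMDP S A n) (o : Fin n → S → A) (C : Finset (Fin n))
    (x : S) (j : Fin n) : M.collectedBefore o C x j 0 = C := by
  simp [collectedBefore]

theorem subset_collectedBefore (M : CollectibleMDP S A n) (o : Fin n → S → A)
    (C : Finset (Fin n)) (x : S) (j : Fin n) (t : ℕ) : C ⊆ M.collectedBefore o C x j t :=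
  subset_union_left

theorem card_collectedBefore_succ (M : CollectibleMDP S A n) (o : Fin n → S → A)
    (C : Finset (Fin n)) (x : S) (j : Fin n) (t : ℕ) :
    (#(M.collectedBefore o C x j (t + 1)) : ℝ) = #(M.collectedBefore o C x j t) +
      M.reward (M.collectedBefore o C x j t) (M.optionState o j x t) := by
  classical
  have hunion : M.collectedBefore o C x j (t + 1) = M.collectedBefore o C x j t ∪
      {i ∈ (M.collectedBefore o C x j t)ᶜ | M.optionState o j x t = M.site i} := by
    ext i
    simp only [collectedBefore, Nat.exists_lt_succ_right, mem_union, mem_filter, mem_univ,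
      true_and, mem_compl]
    grind
  rw [hunion, reward_eq_card, card_union_of_disjoint, Nat.cast_add]
  exact disjoint_compl_right.mono_right (filter_subset _ _)

theorem sum_reward_collectedBefore (M : CollectibleMDP S A n) (o : Fin n → S → A)
    (C : Finset (Fin n)) (x : S) (j : Fin n) (m : ℕ) :
    ∑ t ∈ range m, M.reward (M.collectedBefore o C x j t) (M.optionState o j x t) =
      #(M.collectedBefore o C x j m \ C) := by
  rw [cast_card_sdiff (M.subset_collectedBefore o C x j m)]
  nth_rw 3 [← M.collectedBefore_zero o C x j]
  rw [← sum_range_sub fun t => (#(M.collectedBefore o C x j t) : ℝ)]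
  exact sum_congr rfl fun t _ => by rw [card_collectedBefore_succ, add_sub_cancel_left]

theorem mem_collectedAfter (h : M.optionState o j x (M.dist x (M.site j)) = M.site j) :
    j ∈ M.collectedAfter o C x j := by
  simp only [collectedAfter, collectedBefore, mem_union, mem_filter, mem_univ, true_and]
  exact .inr ⟨_, Nat.lt_succ_self _, h⟩

theorem legReturn_nonneg (hγ0 : 0 ≤ γ) : 0 ≤ M.legReturn γ o C x j :=
  sum_nonneg fun _ _ => mul_nonneg (pow_nonneg hγ0 _) (M.reward_nonneg _ _)

theorem pow_mul_card_le_legReturn (hγ0 : 0 ≤ γ) (hγ1 : γ ≤ 1) :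
    γ ^ M.dist x (M.site j) * #(M.collectedAfter o C x j \ C) ≤ M.legReturn γ o C x j := by
  rw [collectedAfter, ← sum_reward_collectedBefore, mul_sum]
  refine sum_le_sum fun t ht => mul_le_mul_of_nonneg_right ?_ (M.reward_nonneg _ _)
  exact pow_le_pow_of_le_one hγ0 hγ1 (Nat.lt_succ_iff.1 (mem_range.1 ht))

theorem pow_le_legReturn (hγ0 : 0 ≤ γ) (hγ1 : γ ≤ 1)
    (h : M.optionState o j x (M.dist x (M.site j)) = M.site j) (hj : j ∉ C) :
    γ ^ M.dist x (M.site j) ≤ M.legReturn γ o C x j := by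
  refine le_trans (le_mul_of_one_le_right (pow_nonneg hγ0 _) ?_)
    (pow_mul_card_le_legReturn hγ0 hγ1)
  exact_mod_cast card_pos.2 ⟨j, mem_sdiff.2 ⟨mem_collectedAfter h, hj⟩⟩

end Options

/-! ### Nearest neighbour and Random-NN -/

section NearestNeighbor

variable {M : CollectibleMDP S A n} {o : Fin n → S → A}
  {pick : List (Fin n) → S → Finset (Fin n) → Fin n} {γ : ℝ}

theorem pickReturn_nonneg (hγ0 : 0 ≤ γ) (m : ℕ) (h : List (Fin n)) (x : S)
    (C : Finset (Fin n)) : 0 ≤ M.pickReturn γ o pick m h x C := by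
  induction m generalizing h x C with
  | zero => exact le_rfl
  | succ m ih =>
    rw [pickReturn]
    split_ifs
    · exact le_rfl
    · exact add_nonneg (legReturn_nonneg hγ0) (mul_nonneg (pow_nonneg hγ0 _) (ih _ _ _))

theorem firstThenNNReturn_nonneg (hγ0 : 0 ≤ γ) (j : Fin n) :
    0 ≤ M.firstThenNNReturn γ o pick j :=
  add_nonneg (legReturn_nonneg hγ0) (mul_nonneg (pow_nonneg hγ0 _) (pickReturn_nonneg hγ0 _ _ _ _))

theorem legReturn_le_pickReturn_succ (hγ0 : 0 ≤ γ) {C : Finset (Fin n)} (hC : C ≠ univ) (m : ℕ)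
    (h : List (Fin n)) (x : S) :
    M.legReturn γ o C x (pick h x C) ≤ M.pickReturn γ o pick (m + 1) h x C := by
  rw [pickReturn, if_neg hC]
  exact le_add_of_nonneg_right (mul_nonneg (pow_nonneg hγ0 _) (pickReturn_nonneg hγ0 _ _ _ _))

theorem OptimalOptions.pow_le_nnReturn (ho : M.OptimalOptions o) (hpick : M.IsNearestNeighbor pick)
    (hn : n ≠ 0) (hγ0 : 0 ≤ γ) (hγ1 : γ ≤ 1) :
    γ ^ M.dist M.init (M.site (pick [] M.init ∅)) ≤ M.nnReturn γ o pick := by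
  obtain ⟨m, rfl⟩ := Nat.exists_eq_succ_of_ne_zero hn
  exact (pow_le_legReturn hγ0 hγ1 (ho _ (.inl rfl) _) (notMem_empty _)).trans
    (legReturn_le_pickReturn_succ hγ0 univ_nonempty.ne_empty.symm m [] M.init)

/-- The factor `γ ^ δ` on the right turns the time bound `(2 ^ p - 1) * δ` into `2 ^ p * δ`. The
time doubles with `p` because the reward picked is at most `δ` away, so that from there the
rewards of `G` are within `2 * δ`. -/
theorem OptimalOptions.pow_mul_min_le_pow_mul_pickReturn (ho : M.OptimalOptions o)
    (hsymm : ∀ i j : Fin n, M.dist (M.site i) (M.site j) = M.dist (M.site j) (M.site i))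
    (hpick : M.IsNearestNeighbor pick) (hγ0 : 0 ≤ γ) (hγ1 : γ ≤ 1) {G : Finset (Fin n)}
    {p m : ℕ} (hpm : p ≤ m) (h : List (Fin n)) {i : Fin n} (C : Finset (Fin n)) {δ : ℕ}
    (hG : ∀ g ∈ G, M.dist (M.site i) (M.site g) ≤ δ) :
    γ ^ (2 ^ p * δ) * (min p #(G \ C) : ℕ) ≤ γ ^ δ * M.pickReturn γ o pick m h (M.site i) C := by
  have rhs_nonneg (m h i C δ) : 0 ≤ γ ^ δ * M.pickReturn γ o pick m h (M.site i) C :=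
    mul_nonneg (pow_nonneg hγ0 _) (pickReturn_nonneg hγ0 _ _ _ _)
  induction p generalizing m h i C δ with
  | zero => simpa using rhs_nonneg m h i C δ
  | succ p ih =>
    obtain ⟨m, rfl⟩ := Nat.exists_eq_add_of_le' (Nat.one_le_of_lt hpm)
    by_cases hGC : G ⊆ C
    · simpa [sdiff_eq_empty_iff_subset.2 hGC] using rhs_nonneg (m + 1) h i C δ
    obtain ⟨g, hg, hgC⟩ := not_subset.1 hGC
    have hC : C ≠ univ := ne_of_mem_of_not_mem' (mem_univ g) hgC |>.symm
    obtain ⟨hjC, hnearest⟩ := hpick h (M.site i) C hC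
    rw [pickReturn, if_neg hC]
    set j := pick h (M.site i) C
    set C' := M.collectedAfter o C (M.site i) j
    set d := M.dist (M.site i) (M.site j)
    have hdδ : d ≤ δ := (hnearest g hgC).trans (hG g hg)
    have hG' : ∀ g ∈ G, M.dist (M.site j) (M.site g) ≤ 2 * δ := fun g hg => by
      have htri := (ho.reachable_site_site j i).dist_triangle (ho.reachable_site_site i g)
      linarith [hG g hg, hsymm j i]
    have hnew : (C' \ C).Nonempty :=
      ⟨j, mem_sdiff.2 ⟨mem_collectedAfter (ho _ (.inr ⟨i, rfl⟩) j), hjC⟩⟩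
    set new := #(C' \ C)
    set rest := min p #(G \ C')
    set V := M.pickReturn γ o pick m (h ++ [j]) (M.site j) C'
    have hleg : γ ^ d * new ≤ M.legReturn γ o C (M.site i) j := pow_mul_card_le_legReturn hγ0 hγ1
    have hrest : γ ^ (2 ^ p * (2 * δ)) * rest ≤ γ ^ (δ + d) * V :=
      (ih (Nat.le_of_succ_le_succ hpm) _ _ hG').trans <| mul_le_mul_of_nonneg_right
        (pow_le_pow_of_le_one hγ0 hγ1 (by omega)) (pickReturn_nonneg hγ0 _ _ _ _)
    have hexp : 2 * δ ≤ 2 ^ p * (2 * δ) := Nat.le_mul_of_pos_left _ (Nat.two_pow_pos p)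
    calc γ ^ (2 ^ (p + 1) * δ) * (min (p + 1) #(G \ C) : ℕ)
        ≤ γ ^ (2 ^ p * (2 * δ)) * (new + rest) := by
          rw [pow_succ 2, mul_assoc]
          gcongr
          exact_mod_cast min_succ_card_sdiff_le hnew G p
      _ = γ ^ (2 ^ p * (2 * δ)) * new + γ ^ (2 ^ p * (2 * δ)) * rest := mul_add _ _ _
      _ ≤ γ ^ (δ + d) * new + γ ^ (δ + d) * V := by
          gcongr ?_ * _ + ?_
          exact pow_le_pow_of_le_one hγ0 hγ1 (by omega)
      _ = γ ^ δ * (γ ^ d * new + γ ^ d * V) := by ring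
      _ ≤ γ ^ δ * (M.legReturn γ o C (M.site i) j + γ ^ d * V) := by gcongr

theorem OptimalOptions.mul_pow_le_firstThenNNReturn (ho : M.OptimalOptions o)
    (hsymm : ∀ i j : Fin n, M.dist (M.site i) (M.site j) = M.dist (M.site j) (M.site i))
    (hpick : M.IsNearestNeighbor pick) (hγ0 : 0 ≤ γ) (hγ1 : γ ≤ 1) {G : Finset (Fin n)}
    {p : ℕ} (hp : p ≤ #G) {i : Fin n} {δ : ℕ}
    (hG : ∀ g ∈ G, M.dist (M.site i) (M.site g) ≤ δ) :
    p * γ ^ (M.dist M.init (M.site i) + 2 ^ p * δ) ≤ M.firstThenNNReturn γ o pick i := by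
  set d := M.dist M.init (M.site i)
  set C := M.collectedAfter o ∅ M.init i
  set V := M.pickReturn γ o pick n [i] (M.site i) C
  have hcount : p ≤ #C + min p #(G \ C) := by
    have := card_le_card_sdiff_add_card (s := G) (t := C)
    omega
  have hleg : γ ^ d * #C ≤ M.legReturn γ o ∅ M.init i := by
    simpa only [sdiff_empty] using pow_mul_card_le_legReturn (M := M) (o := o) (C := ∅) hγ0 hγ1
  have hV : γ ^ (2 ^ p * δ) * (min p #(G \ C) : ℕ) ≤ V :=
    (ho.pow_mul_min_le_pow_mul_pickReturn hsymm hpick hγ0 hγ1 (hp.trans (card_finset_fin_le G))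
      [i] C hG).trans (mul_le_of_le_one_left (pickReturn_nonneg hγ0 _ _ _ _) (pow_le_one₀ hγ0 hγ1))
  calc (p : ℝ) * γ ^ (d + 2 ^ p * δ)
      ≤ (#C + (min p #(G \ C) : ℕ)) * γ ^ (d + 2 ^ p * δ) := by
        gcongr
        exact_mod_cast hcount
    _ = γ ^ d * (γ ^ (2 ^ p * δ) * #C + γ ^ (2 ^ p * δ) * (min p #(G \ C) : ℕ)) := by ring
    _ ≤ γ ^ d * (#C + V) := by
        gcongr
        exact mul_le_of_le_one_left (Nat.cast_nonneg _) (pow_le_one₀ hγ0 hγ1)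
    _ = γ ^ d * #C + γ ^ d * V := mul_add _ _ _
    _ ≤ M.legReturn γ o ∅ M.init i + γ ^ d * V := by gcongr

theorem OptimalOptions.pow_le_firstThenNNReturn_div (ho : M.OptimalOptions o)
    (hsymm : ∀ i j : Fin n, M.dist (M.site i) (M.site j) = M.dist (M.site j) (M.site i))
    (hpick : M.IsNearestNeighbor pick) (hγ0 : 0 ≤ γ) (hγ1 : γ ≤ 1) (σ : Equiv.Perm (Fin n))
    {p : ℕ} (hp0 : 0 < p) {k : Fin n} {δ : ℕ}
    (hp : p ≤ #{l | Nat.dist (M.tourTime σ k) (M.tourTime σ l) ≤ δ}) :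
    γ ^ (M.tourTime σ k + 2 ^ p * δ) ≤ M.firstThenNNReturn γ o pick (σ k) / p := by
  set near : Finset (Fin n) := {l | Nat.dist (M.tourTime σ k) (M.tourTime σ l) ≤ δ}
  have hnear : ∀ g ∈ near.map σ.toEmbedding, M.dist (M.site (σ k)) (M.site g) ≤ δ := by
    simp only [mem_map, forall_exists_index, and_imp, forall_apply_eq_imp_iff₂]
    exact fun l hl => (dist_site_le_natDist_tourTime σ ho.reachable_site_site hsymm k l).trans
      (mem_filter.1 hl).2
  rw [le_div_iff₀' (by exact_mod_cast hp0)]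
  have htime := dist_init_site_le_tourTime σ ho.reachable_init_site ho.reachable_site_site k
  calc p * γ ^ (M.tourTime σ k + 2 ^ p * δ)
      ≤ p * γ ^ (M.dist M.init (M.site (σ k)) + 2 ^ p * δ) := by
        gcongr ?_ * ?_
        exact pow_le_pow_of_le_one hγ0 hγ1 (by omega)
    _ ≤ M.firstThenNNReturn γ o pick (σ k) :=
        ho.mul_pow_le_firstThenNNReturn hsymm hpick hγ0 hγ1 (hp.trans_eq (card_map _).symm) hnear

theorem opt_nonneg (hγ0 : 0 ≤ γ) : 0 ≤ M.opt γ :=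
  (sum_nonneg fun _ _ => pow_nonneg hγ0 _).trans (le_sup' (M.tourReturn γ) (mem_univ 1))

theorem OptimalOptions.opt_le (ho : M.OptimalOptions o)
    (hsymm : ∀ i j : Fin n, M.dist (M.site i) (M.site j) = M.dist (M.site j) (M.site i))
    (hpick : M.IsNearestNeighbor pick) (hγ0 : 0 ≤ γ) (hγ1 : γ ≤ 1) {p : ℕ} (hp0 : 0 < p)
    (hp : p ≤ n) :
    M.opt γ ≤ 2 / p * ∑ j, M.firstThenNNReturn γ o pick j +
      2 * p * 2 ^ p * M.nnReturn γ o pick := by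
  have hn : n ≠ 0 := (hp0.trans_le hp).ne'
  have : NeZero n := ⟨hn⟩
  have hnearest (k : Fin n) :
      M.dist M.init (M.site (pick [] M.init ∅)) ≤ M.dist M.init (M.site k) :=
    (hpick [] M.init ∅ univ_nonempty.ne_empty.symm).2 k (notMem_empty k)
  refine sup'_le _ _ fun σ _ => ?_
  calc M.tourReturn γ σ = ∑ k, γ ^ M.tourTime σ k := rfl
    _ ≤ 2 * ∑ k, M.firstThenNNReturn γ o pick (σ k) / p +
          2 * p * (2 ^ p : ℕ) * γ ^ M.dist M.init (M.site (pick [] M.init ∅)) :=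
        sum_pow_le_of_dense_le hγ0 hγ1
          (fun k => (hnearest (σ k)).trans
            (dist_init_site_le_tourTime σ ho.reachable_init_site ho.reachable_site_site k))
          (Nat.two_pow_pos p).ne' (by rwa [Fintype.card_fin])
          (fun k => div_nonneg (firstThenNNReturn_nonneg hγ0 _) p.cast_nonneg)
          fun k δ hk => ho.pow_le_firstThenNNReturn_div hsymm hpick hγ0 hγ1 σ hp0 hk
    _ ≤ 2 * ∑ k, M.firstThenNNReturn γ o pick (σ k) / p +
          2 * p * (2 ^ p : ℕ) * M.nnReturn γ o pick := by
        gcongr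
        exact ho.pow_le_nnReturn hpick hn hγ0 hγ1
    _ = _ := by
        rw [Equiv.sum_comp σ fun j => M.firstThenNNReturn γ o pick j / p, ← sum_div]
        push_cast
        ring

theorem OptimalOptions.mul_opt_le_randomNNReturn (ho : M.OptimalOptions o)
    (hsymm : ∀ i j : Fin n, M.dist (M.site i) (M.site j) = M.dist (M.site j) (M.site i))
    (hpick : M.IsNearestNeighbor pick) (hγ0 : 0 ≤ γ) (hγ1 : γ ≤ 1) {p : ℕ} (hp0 : 0 < p)
    (hp : p ≤ n) (hpow : p ^ 2 * 2 ^ p ≤ 8 * n) :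
    p / (32 * n) * M.opt γ ≤ M.randomNNReturn γ o pick := by
  have hopt := ho.opt_le hsymm hpick hγ0 hγ1 hp0 hp
  have hF : 0 ≤ ∑ j, M.firstThenNNReturn γ o pick j :=
    sum_nonneg fun j _ => firstThenNNReturn_nonneg hγ0 j
  have hN : 0 ≤ M.nnReturn γ o pick := pickReturn_nonneg hγ0 _ _ _ _
  rw [randomNNReturn, ← mul_sum]
  set F := ∑ j, M.firstThenNNReturn γ o pick j
  set N := M.nnReturn γ o pick
  have hpow' : (p : ℝ) ^ 2 * 2 ^ p ≤ 8 * n := by exact_mod_cast hpow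
  have hn0 : (0 : ℝ) < n := by exact_mod_cast hp0.trans_le hp
  calc p / (32 * n) * M.opt γ
      ≤ p / (32 * n) * (2 / p * F + 2 * p * 2 ^ p * N) := by gcongr
    _ = 1 / 16 * (p ^ 2 * 2 ^ p / n) * N + 1 / 16 * (1 / n * F) := by
        field_simp
        ring
    _ ≤ 1 / 16 * (8 * n / n) * N + 1 / 2 * (1 / n * F) := by
        gcongr
        norm_num
    _ = 1 / 2 * N + 1 / 2 * (1 / n * F) := by
        field_simp
        ring

end NearestNeighbor

end CollectibleMDP

theorem mainTheorem4 :
    ∃ c : ℝ, 0 < c ∧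
      ∀ (n : ℕ) (_hn : 1 ≤ n) (S A : Type*) (M : CollectibleMDP S A n)
        (_hsymm : ∀ i j : Fin n,
          M.dist (M.site i) (M.site j) = M.dist (M.site j) (M.site i))
        (o : Fin n → S → A) (_ho : M.OptimalOptions o)
        (pick : List (Fin n) → S → Finset (Fin n) → Fin n) (_hpick : M.IsNearestNeighbor pick)
        (γ : ℝ) (_hγ0 : 0 ≤ γ) (_hγ1 : γ ≤ 1),
        c * (Real.log n / n) * M.opt γ ≤ M.randomNNReturn γ o pick := by
  refine ⟨1 / 96, by norm_num, fun n hn S A M hsymm o ho pick hpick γ hγ0 hγ1 => ?_⟩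
  obtain ⟨p, hp0, hpn, hlog, hpow⟩ :=
    exists_log_le_three_mul_and_sq_mul_two_pow_le (Nat.one_le_iff_ne_zero.1 hn)
  have hopt := CollectibleMDP.opt_nonneg (M := M) hγ0
  calc 1 / 96 * (Real.log n / n) * M.opt γ
      ≤ 1 / 96 * (3 * p / n) * M.opt γ := by gcongr
    _ = p / (32 * n) * M.opt γ := by ring
    _ ≤ M.randomNNReturn γ o pick :=
        ho.mul_opt_le_randomNNReturn hsymm hpick hγ0 hγ1 hp0 hpn hpow
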